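/- Let $(X,d)$ be a compact ultrametric space; balls are closed balls of positive radius, regarded as subsets of $X$. A similarity structure $\mathrm{Sim}$ on $X$ assigns to each pair of balls $B_1,B_2$ a (possibly empty) set $\mathrm{Sim}(B_1,B_2)$ of surjective similarities $B_1\to B_2$ (bijections $h$ with $d(h(x),h(y))=\lambda\, d(x,y)$ for some constant $\lambda>0$), such that identities belong to it and it is closed under inverses, compositions, and restrictions to subballs ($h\in \mathrm{Sim}(B_1,B_2)$ and $B_3\subseteq B_1$ imply $h|_{B_3}\in\mathrm{Sim}(B_3,h(B_3))$). It is countable if every $\mathrm{Sim}(B_1,B_2)$ is countable. Its group $\Gamma(\mathrm{Sim})$ consists of all homeomorphisms $g$ of $X$ such that every $x\in X$ lies in a ball $B$ for which $g(B)$ is a ball and $g|_B\in\mathrm{Sim}(B,g(B))$. A group $\Gamma$ of homeomorphisms of $X$ is a CSS$^*$ group if $X$ is infinite, $\Gamma=\Gamma(\mathrm{Sim})$ for a countable similarity structure $\mathrm{Sim}$, every infinite ball contains two disjoint infinite balls, and for every ball $B\subsetneq X$ and every infinite ball $D\subsetneq X$ there is a ball $D_0\subseteq D$ with $\mathrm{Sim}(B,D_0)\neq\emptyset$.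 For a discrete group $G$ let $L(G)=\{\lambda_g : g\in G\}''\subseteq B(\ell^2(G))$ be the group von Neumann algebra, where $\lambda$ is the left regular representation; for a subgroup $K\le G$ regard $L(K)$ as the von Neumann subalgebra $\{\lambda_k : k\in K\}''$ of $L(G)$. An inclusion $N\subseteq M$ of factors is irreducible if $N'\cap M=\mathbb C 1$. **Theorem.** Let $X$ be a compact ultrametric space all of whose balls are infinite, and let $\Gamma$ be a CSS$^*$ group on $X$, with commutator subgroup $[\Gamma,\Gamma]$. Then $L([\Gamma,\Gamma])$ and $L(\Gamma)$ are II$_1$ factors, and the inclusion $L([\Gamma,\Gamma])\subseteq L(\Gamma)$ is irreducible, i.e. $L([\Gamma,\Gamma])'\cap L(\Gamma)=\mathbb C 1$. -/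

import Mathlib

open scoped ENNReal

/-! ## Similarity structures on ultrametric spaces and their groups -/

/-- Closed balls of positive radius, regarded as subsets of `X`
(the centre and the radius are not part of the data; the whole space may be a closed ball). -/
def ClosedBall (X : Type*) [MetricSpace X] : Type _ :=
  {B : Set X // ∃ (x : X) (r : ℝ), 0 < r ∧ B = Metric.closedBall x r}

/-- A similarity structure on `X`: to every pair of closed balls `B₁`, `B₂` one assigns a
(possibly empty) set of surjective similarities `B₁ → B₂`, containing the identities and stable
under inverses, compositions and restrictions to smaller closed balls. -/
structure SimilarityStructure (X : Type*) [MetricSpace X] where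
  Sim : ∀ B₁ B₂ : ClosedBall X, Set (B₁.1 ≃ B₂.1)
  similarity : ∀ {B₁ B₂ : ClosedBall X} {h : B₁.1 ≃ B₂.1}, h ∈ Sim B₁ B₂ →
    ∃ c : ℝ, 0 < c ∧ ∀ x y : B₁.1, dist (h x) (h y) = c * dist x y
  refl_mem : ∀ B : ClosedBall X, Equiv.refl B.1 ∈ Sim B B
  symm_mem : ∀ {B₁ B₂ : ClosedBall X} {h : B₁.1 ≃ B₂.1}, h ∈ Sim B₁ B₂ → h.symm ∈ Sim B₂ B₁
  trans_mem : ∀ {B₁ B₂ B₃ : ClosedBall X} {h₁ : B₁.1 ≃ B₂.1} {h₂ : B₂.1 ≃ B₃.1},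
    h₁ ∈ Sim B₁ B₂ → h₂ ∈ Sim B₂ B₃ → h₁.trans h₂ ∈ Sim B₁ B₃
  /-- If `k : B₃ → B₄` is the restriction of `h ∈ Sim B₁ B₂` to a closed ball `B₃ ⊆ B₁`, where
  `B₄ = h(B₃)`, then `k ∈ Sim B₃ B₄`. -/
  restrict_mem : ∀ {B₁ B₂ B₃ B₄ : ClosedBall X} {h : B₁.1 ≃ B₂.1} (hsub : B₃.1 ⊆ B₁.1)
    (k : B₃.1 ≃ B₄.1), h ∈ Sim B₁ B₂ → (∀ x : B₃.1, (k x : X) = h ⟨x, hsub x.2⟩) →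
    k ∈ Sim B₃ B₄

namespace SimilarityStructure

variable {X : Type*} [MetricSpace X]

/-- The structure is countable if every set `Sim B₁ B₂` is countable. -/
def IsCountable (S : SimilarityStructure X) : Prop :=
  ∀ B₁ B₂ : ClosedBall X, (S.Sim B₁ B₂).Countable

/-- A self-map `g` of `X` is locally determined by the similarity structure if every point lies in
a closed ball `B` such that `B' = g(B)` is a closed ball and `g` restricts to an element of
`Sim B B'`. -/
def LocallyDetermined (S : SimilarityStructure X) (g : X → X) : Prop :=
  ∀ x : X, ∃ B B' : ClosedBall X, x ∈ B.1 ∧ ∃ h ∈ S.Sim B B', ∀ y : B.1, (h y : X) = g y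

variable [IsUltrametricDist X]

/-- In an ultrametric space the image of a closed subball under an element of `Sim B₁ B₂` is a
closed ball, and the restriction to that subball belongs to the structure. -/
theorem exists_restrict (S : SimilarityStructure X) {B₁ B₂ B₃ : ClosedBall X} {h : B₁.1 ≃ B₂.1}
    (hh : h ∈ S.Sim B₁ B₂) (hsub : B₃.1 ⊆ B₁.1) :
    ∃ (B₄ : ClosedBall X) (k : B₃.1 ≃ B₄.1), k ∈ S.Sim B₃ B₄ ∧
      ∀ x : B₃.1, (k x : X) = h ⟨x, hsub x.2⟩ := by
  obtain ⟨c, hc, hd⟩ := S.similarity hh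
  obtain ⟨p, r, hr, hB₃⟩ := B₃.2
  have hp : p ∈ B₃.1 := by rw [hB₃]; exact Metric.mem_closedBall_self hr.le
  obtain ⟨q, s, hs, hB₂⟩ := B₂.2
  have hq : (h ⟨p, hsub hp⟩ : X) ∈ Metric.closedBall q s := by rw [← hB₂]; exact (h _).2
  rw [IsUltrametricDist.closedBall_eq_of_mem hq] at hB₂
  set q' : X := ((h ⟨p, hsub hp⟩ : B₂.1) : X) with hq'
  let B₄ : ClosedBall X :=
    ⟨Metric.closedBall q' (min s (c * r)), q', min s (c * r), lt_min hs (mul_pos hc hr), rfl⟩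
  have hd' : ∀ x : B₁.1, dist (h x : X) q' = c * dist (x : X) p := fun x =>
    hd x ⟨p, hsub hp⟩
  have hto : ∀ x : B₃.1, (h ⟨x, hsub x.2⟩ : X) ∈ B₄.1 := by
    intro x
    refine Metric.mem_closedBall.2 (le_min ?_ ?_)
    · exact Metric.mem_closedBall.1 (hB₂.subset (h ⟨x, hsub x.2⟩).2)
    · rw [hd']
      exact mul_le_mul_of_nonneg_left (Metric.mem_closedBall.1 (hB₃.subset x.2)) hc.le
  have hin : ∀ z : B₄.1, (z : X) ∈ B₂.1 := by
    intro z
    rw [hB₂]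
    exact Metric.mem_closedBall.2 ((Metric.mem_closedBall.1 z.2).trans (min_le_left _ _))
  have hfrom : ∀ z : B₄.1, (h.symm ⟨z, hin z⟩ : X) ∈ B₃.1 := by
    intro z
    rw [hB₃]
    have h1 := hd' (h.symm ⟨z, hin z⟩)
    rw [Equiv.apply_symm_apply] at h1
    have h2 : dist (z : X) q' ≤ c * r :=
      (Metric.mem_closedBall.1 z.2).trans (min_le_right _ _)
    refine Metric.mem_closedBall.2 (le_of_mul_le_mul_left ?_ hc)
    rw [← h1]
    exact h2
  let k : B₃.1 ≃ B₄.1 :=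
    { toFun := fun x => ⟨h ⟨x, hsub x.2⟩, hto x⟩
      invFun := fun z => ⟨h.symm ⟨z, hin z⟩, hfrom z⟩
      left_inv := fun x => by simp
      right_inv := fun z => by simp }
  exact ⟨B₄, k, S.restrict_mem hsub k hh fun _ => rfl, fun _ => rfl⟩

/-- The similarity structure group `Γ(Sim)`: all homeomorphisms of `X` that are locally
determined by the similarity structure. -/
def group (S : SimilarityStructure X) : Subgroup (X ≃ₜ X) where
  carrier := {g | S.LocallyDetermined g}
  one_mem' := fun x =>
    let B : ClosedBall X := ⟨Metric.closedBall x 1, x, 1, one_pos, rfl⟩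
    ⟨B, B, Metric.mem_closedBall_self zero_le_one, Equiv.refl _, S.refl_mem B, fun _ => rfl⟩
  inv_mem' := by
    intro g hg x
    obtain ⟨B, B', hx, h, hh, hgh⟩ := hg (g⁻¹ x)
    have hgx : g (g⁻¹ x) = x := g.apply_symm_apply x
    refine ⟨B', B, ?_, h.symm, S.symm_mem hh, fun y => ?_⟩
    · have := (h ⟨g⁻¹ x, hx⟩).2
      rwa [hgh, hgx] at this
    · have h1 := hgh (h.symm y)
      rw [Equiv.apply_symm_apply] at h1
      have h2 : g⁻¹ (g (h.symm y : X)) = h.symm y := g.symm_apply_apply _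
      rw [h1, h2]
  mul_mem' := by
    intro f g hf hg x
    obtain ⟨B, B', hx, h, hh, hgh⟩ := hg x
    obtain ⟨C, C', hx', k, hk, hfk⟩ := hf (g x)
    have hxB' : g x ∈ B'.1 := by
      have := (h ⟨x, hx⟩).2
      rwa [hgh] at this
    have hnest : B'.1 ⊆ C.1 ∨ C.1 ⊆ B'.1 := by
      obtain ⟨p, r, -, hp⟩ := B'.2
      obtain ⟨q, s, -, hq⟩ := C.2
      rw [hp] at hxB' ⊢
      rw [hq] at hx' ⊢
      rw [IsUltrametricDist.closedBall_eq_of_mem hxB', IsUltrametricDist.closedBall_eq_of_mem hx']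
      exact (le_total r s).imp Metric.closedBall_subset_closedBall
        Metric.closedBall_subset_closedBall
    rcases hnest with hsub | hsub
    · obtain ⟨E, k', hk', hkk⟩ := S.exists_restrict hk hsub
      refine ⟨B, E, hx, h.trans k', S.trans_mem hh hk', fun y => ?_⟩
      rw [Equiv.trans_apply, hkk, hfk]
      exact congrArg f (hgh y)
    · obtain ⟨E, k', hk', hkk⟩ := S.exists_restrict (S.symm_mem hh) hsub
      have hE : ∀ y : E.1, g (y : X) = k'.symm y := by
        intro y
        have h1 := hkk (k'.symm y)
        rw [Equiv.apply_symm_apply] at h1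
        rw [h1, ← hgh, Equiv.apply_symm_apply]
      refine ⟨E, C', ?_, k'.symm.trans k, S.trans_mem (S.symm_mem hk') hk, fun y => ?_⟩
      · have h1 := hkk ⟨g x, hx'⟩
        have h2 : h.symm ⟨g x, hsub hx'⟩ = ⟨x, hx⟩ := by
          rw [Equiv.symm_apply_eq]
          exact Subtype.ext (hgh ⟨x, hx⟩).symm
        rw [h2] at h1
        have h3 := (k' ⟨g x, hx'⟩).2
        rwa [h1] at h3
      · rw [Equiv.trans_apply, hfk, ← hE]
        rfl

end SimilarityStructure

/-- `Γ` is a CSS* group on the compact ultrametric space `X`: the space is infinite, `Γ` is the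
group of a countable similarity structure, every infinite ball contains two disjoint infinite
balls, and every proper closed ball `B` is similar, through the structure, to a subball of any
given infinite proper closed ball `D`. -/
def IsCSSStarGroup {X : Type*} [MetricSpace X] [CompactSpace X] [IsUltrametricDist X]
    (Γ : Subgroup (X ≃ₜ X)) : Prop :=
  Infinite X ∧ ∃ S : SimilarityStructure X, S.IsCountable ∧ Γ = S.group ∧
    (∀ B : ClosedBall X, B.1.Infinite →
      ∃ B₁ B₂ : ClosedBall X, B₁.1 ⊆ B.1 ∧ B₂.1 ⊆ B.1 ∧ B₁.1.Infinite ∧ B₂.1.Infinite ∧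
        Disjoint B₁.1 B₂.1) ∧
    (∀ B D : ClosedBall X, B.1 ≠ Set.univ → D.1 ≠ Set.univ → D.1.Infinite →
      ∃ D₀ : ClosedBall X, D₀.1 ⊆ D.1 ∧ (S.Sim B D₀).Nonempty)

/-! ## Factors and group von Neumann algebras -/

section VonNeumann

variable {H : Type*} [NormedAddCommGroup H] [InnerProductSpace ℂ H] [CompleteSpace H]

/-- The scalar operators `ℂ · 1` on `H`. -/
def scalarOperators (H : Type*) [NormedAddCommGroup H] [InnerProductSpace ℂ H] :
    Set (H →L[ℂ] H) :=
  Set.range fun c : ℂ => c • (1 : H →L[ℂ] H)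

/-- A factor is a von Neumann algebra with trivial centre: `M ∩ M' = ℂ · 1`. -/
def VonNeumannAlgebra.IsFactor (M : VonNeumannAlgebra H) : Prop :=
  (M : Set (H →L[ℂ] H)) ∩ M.commutant = scalarOperators H

open scoped ComplexOrder in
/-- A faithful normal tracial state on `M`. Normality is expressed by the usual form
`τ(x) = ∑ ⟨ξₙ, x ξₙ⟩` with `∑ ‖ξₙ‖² < ∞`. -/
structure VonNeumannAlgebra.IsFaithfulNormalTrace (M : VonNeumannAlgebra H)
    (τ : M.toStarSubalgebra →ₗ[ℂ] ℂ) : Prop where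
  map_one : τ 1 = 1
  nonneg : ∀ x, 0 ≤ τ (star x * x)
  tracial : ∀ x y, τ (x * y) = τ (y * x)
  faithful : ∀ x, τ (star x * x) = 0 → x = 0
  normal : ∃ ξ : ℕ → H, (Summable fun n => ‖ξ n‖ ^ 2) ∧
    ∀ x : M.toStarSubalgebra, HasSum (fun n => inner ℂ (ξ n) ((x : H →L[ℂ] H) (ξ n))) (τ x)

/-- A II₁ factor is an infinite-dimensional factor with a faithful normal tracial state. -/
def VonNeumannAlgebra.IsTypeIIOneFactor (M : VonNeumannAlgebra H) : Prop :=
  M.IsFactor ∧ ¬ FiniteDimensional ℂ M.toStarSubalgebra ∧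
    ∃ τ : M.toStarSubalgebra →ₗ[ℂ] ℂ, M.IsFaithfulNormalTrace τ

/-- An inclusion of factors `N ⊆ M` is irreducible if `N' ∩ M = ℂ · 1`. -/
def VonNeumannAlgebra.IsIrreducibleInclusion (N M : VonNeumannAlgebra H) : Prop :=
  N.IsFactor ∧ M.IsFactor ∧ N ≤ M ∧
    (N.commutant : Set (H →L[ℂ] H)) ∩ M = scalarOperators H

/-- The von Neumann algebra generated by a set of operators: the double commutant of
`s ∪ s*`. -/
noncomputable def generatedVonNeumannAlgebra (s : Set (H →L[ℂ] H)) : VonNeumannAlgebra H where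
  toStarSubalgebra :=
    StarSubalgebra.centralizer ℂ (StarSubalgebra.centralizer ℂ s : Set (H →L[ℂ] H))
  centralizer_centralizer' := by
    change Set.centralizer (Set.centralizer
      ((StarSubalgebra.centralizer ℂ (StarSubalgebra.centralizer ℂ s : Set (H →L[ℂ] H)) :
        StarSubalgebra ℂ (H →L[ℂ] H)) : Set (H →L[ℂ] H))) =
      ((StarSubalgebra.centralizer ℂ (StarSubalgebra.centralizer ℂ s : Set (H →L[ℂ] H)) :
        StarSubalgebra ℂ (H →L[ℂ] H)) : Set (H →L[ℂ] H))
    rw [StarSubalgebra.coe_centralizer_centralizer, Set.centralizer_centralizer_centralizer]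

end VonNeumann

section GroupVonNeumann

/-- The Hilbert space `ℓ²(G)`. -/
abbrev EllTwo (G : Type*) : Type _ := lp (fun _ : G => ℂ) 2

variable (G : Type*) [Group G]

/-- The left regular representation of `G` on `ℓ²(G)`: `(λ_g f)(x) = f(g⁻¹ x)`. -/
noncomputable def leftRegularRep (g : G) : EllTwo G →L[ℂ] EllTwo G :=
  LinearIsometry.toContinuousLinearMap
    { toFun := fun f => ⟨fun x => f (g⁻¹ * x), memℓp_gen <|
        ((Equiv.mulLeft g⁻¹).summable_iff (f := fun x => ‖f x‖ ^ (2 : ℝ≥0∞).toReal)).2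
          ((lp.memℓp f).summable (by norm_num))⟩
      map_add' := fun _ _ => rfl
      map_smul' := fun _ _ => rfl
      norm_map' := fun f => by
        rw [lp.norm_eq_tsum_rpow (by norm_num), lp.norm_eq_tsum_rpow (by norm_num)]
        congr 1
        exact (Equiv.mulLeft g⁻¹).tsum_eq fun x => ‖f x‖ ^ (2 : ℝ≥0∞).toReal }

/-- The group von Neumann algebra `L(G) = {λ_g : g ∈ G}''` on `ℓ²(G)`. -/
noncomputable def groupVonNeumannAlgebra : VonNeumannAlgebra (EllTwo G) :=
  generatedVonNeumannAlgebra (Set.range (leftRegularRep G))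

variable {G}

/-- For a subgroup `K` of `G`, the group von Neumann algebra `L(K)` in its canonical position
inside `L(G)`: the von Neumann algebra on `ℓ²(G)` generated by the `λ_k`, `k ∈ K`. -/
noncomputable def subgroupVonNeumannAlgebra (K : Subgroup G) : VonNeumannAlgebra (EllTwo G) :=
  generatedVonNeumannAlgebra (leftRegularRep G '' K)

end GroupVonNeumann

/-! The operator side reduces to group theory. An element `x` of $L(G)$ commutes with right
translations, so it is determined by the square-summable function $f = x\delta_1$. If `x` also
commutes with $L(K)$, then $f$ is constant on $K$-conjugacy classes, hence zero wherever that class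
is infinite. If every $g \ne 1$ has infinitely many $K$-conjugates, only $f(1)$ survives and `x` is
scalar (`relativeCommutant_eq_scalarOperators`). Irreducibility and both factor statements follow
from this, and the vector state at $\delta_1$ is the trace.

On the group side, take $K = [\Gamma,\Gamma]$. Swapping disjoint similar balls yields nontrivial
commutators supported in any given ball, and splitting balls yields infinitely many
(`infinite_commutator_inf_supportedIn`). A nontrivial $g$ moves some ball $U$ off itself, and
distinct elements supported in $U$ conjugate $g$ to distinct elements (`infinite_conjugates`). -/

/-! ## Group von Neumann algebras -/

section Operators

variable {ι : Type*}

open Classical in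
/-- The standard basis vector `δ_g` of `ℓ²(ι)`. -/
noncomputable def ellTwoDelta (g : ι) : EllTwo ι := lp.single 2 g (1 : ℂ)

open Classical in
theorem ellTwoDelta_apply (g x : ι) : ellTwoDelta g x = if x = g then 1 else 0 := by
  simp [ellTwoDelta, Pi.single_apply]

theorem ellTwoDelta_apply_self (g : ι) : ellTwoDelta g g = 1 := by simp [ellTwoDelta_apply]

theorem inner_ellTwoDelta (g : ι) (f : EllTwo ι) : inner ℂ (ellTwoDelta g) f = f g := by
  classical
  have := lp.inner_single_left (𝕜 := ℂ) (G := fun _ : ι => ℂ) g (1 : ℂ) f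
  simp only [RCLike.inner_apply, map_one, mul_one] at this
  rw [← this, ellTwoDelta]

theorem ContinuousLinearMap.ext_ellTwoDelta {x y : EllTwo ι →L[ℂ] EllTwo ι}
    (h : ∀ g, x (ellTwoDelta g) = y (ellTwoDelta g)) : x = y := by
  classical
  refine lp.ext_continuousLinearMap (by norm_num) fun g => ?_
  ext1
  have := h g
  simp only [ellTwoDelta] at this
  convert this using 1 <;> simp

/-- A square-summable function that is constant on an infinite set vanishes there. -/
theorem EllTwo.eq_zero_of_infinite (f : EllTwo ι) (c : ℂ)
    (h : {i | f i = c}.Infinite) : c = 0 := by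
  by_contra hc
  have hs : Summable fun i => ‖f i‖ ^ (2 : ℝ≥0∞).toReal := (lp.memℓp f).summable (by norm_num)
  have hpos : 0 < ‖c‖ ^ (2 : ℝ≥0∞).toReal := by positivity
  have hev := hs.tendsto_cofinite_zero.eventually (gt_mem_nhds hpos)
  refine h (Set.Finite.subset hev ?_)
  rintro i rfl
  simp

/-! ### Regular representations and the vector $\delta_1$. -/

variable {G : Type*} [Group G]

/-- The right regular representation of `G` on `ℓ²(G)`: `(ρ_g f)(x) = f(x g)`. -/
noncomputable def rightRegularRep (g : G) : EllTwo G →L[ℂ] EllTwo G :=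
  LinearIsometry.toContinuousLinearMap
    { toFun := fun f => ⟨fun x => f (x * g), memℓp_gen <|
        ((Equiv.mulRight g).summable_iff (f := fun x => ‖f x‖ ^ (2 : ℝ≥0∞).toReal)).2
          ((lp.memℓp f).summable (by norm_num))⟩
      map_add' := fun _ _ => rfl
      map_smul' := fun _ _ => rfl
      norm_map' := fun f => by
        rw [lp.norm_eq_tsum_rpow (by norm_num), lp.norm_eq_tsum_rpow (by norm_num)]
        congr 1
        exact (Equiv.mulRight g).tsum_eq fun x => ‖f x‖ ^ (2 : ℝ≥0∞).toReal }

theorem leftRegularRep_apply (g x : G) (f : EllTwo G) : leftRegularRep G g f x = f (g⁻¹ * x) := rfl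

theorem rightRegularRep_apply (g x : G) (f : EllTwo G) : rightRegularRep g f x = f (x * g) := rfl

theorem leftRegularRep_one : leftRegularRep G 1 = 1 := by
  ext f x
  simp [leftRegularRep_apply]

theorem leftRegularRep_mul (g h : G) :
    leftRegularRep G g * leftRegularRep G h = leftRegularRep G (g * h) := by
  ext f x
  simp [leftRegularRep_apply, mul_assoc]

theorem leftRegularRep_comm_rightRegularRep (g h : G) :
    leftRegularRep G g * rightRegularRep h = rightRegularRep h * leftRegularRep G g := by
  ext f x
  simp [leftRegularRep_apply, rightRegularRep_apply, mul_assoc]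

theorem star_leftRegularRep (g : G) : star (leftRegularRep G g) = leftRegularRep G g⁻¹ := by
  have h1 : star (leftRegularRep G g) * leftRegularRep G g = 1 :=
    (ContinuousLinearMap.norm_map_iff_adjoint_comp_self _).1
      (fun f => by
        rw [leftRegularRep, LinearIsometry.coe_toContinuousLinearMap, LinearIsometry.norm_map])
  have h2 : leftRegularRep G g * leftRegularRep G g⁻¹ = 1 := by
    rw [leftRegularRep_mul, mul_inv_cancel, leftRegularRep_one]
  exact left_inv_eq_right_inv h1 h2

theorem leftRegularRep_delta (g h : G) :
    leftRegularRep G g (ellTwoDelta h) = ellTwoDelta (g * h) := by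
  classical
  ext x
  simp [leftRegularRep_apply, ellTwoDelta_apply, inv_mul_eq_iff_eq_mul]

theorem rightRegularRep_delta (g h : G) :
    rightRegularRep g (ellTwoDelta h) = ellTwoDelta (h * g⁻¹) := by
  classical
  ext x
  simp [rightRegularRep_apply, ellTwoDelta_apply, eq_mul_inv_iff_mul_eq]

theorem subset_generatedVonNeumannAlgebra {H : Type*} [NormedAddCommGroup H]
    [InnerProductSpace ℂ H] [CompleteSpace H] (s : Set (H →L[ℂ] H)) :
    s ⊆ generatedVonNeumannAlgebra s := by
  intro x hx
  change x ∈ StarSubalgebra.centralizer ℂ (StarSubalgebra.centralizer ℂ s : Set (H →L[ℂ] H))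
  rw [StarSubalgebra.mem_centralizer_iff]
  intro y hy
  have h1 := (StarSubalgebra.mem_centralizer_iff ℂ).1 hy x hx
  have h2 := (StarSubalgebra.mem_centralizer_iff ℂ).1 (star_mem hy) x hx
  exact ⟨h1.1.symm, h2.1.symm⟩

theorem leftRegularRep_mem_subgroup {K : Subgroup G} {k : G} (hk : k ∈ K) :
    leftRegularRep G k ∈ subgroupVonNeumannAlgebra K :=
  subset_generatedVonNeumannAlgebra _ ⟨k, hk, rfl⟩

theorem leftRegularRep_mem (g : G) : leftRegularRep G g ∈ groupVonNeumannAlgebra G :=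
  subset_generatedVonNeumannAlgebra _ ⟨g, rfl⟩

theorem subgroupVonNeumannAlgebra_le (K : Subgroup G) :
    subgroupVonNeumannAlgebra K ≤ groupVonNeumannAlgebra G := by
  have h := StarSubalgebra.centralizer_le (R := ℂ) _ _
    (Set.image_subset_range (leftRegularRep G) (K : Set G))
  exact fun x hx => StarSubalgebra.centralizer_le (R := ℂ) _ _ h hx

/-- Right translations commute with every $\lambda_h$ and its adjoint $\lambda_{h^{-1}}$, so they
lie in the commutant of the generators. -/
theorem comm_rightRegularRep {x : EllTwo G →L[ℂ] EllTwo G} (hx : x ∈ groupVonNeumannAlgebra G)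
    (g : G) : x * rightRegularRep g = rightRegularRep g * x := by
  have hρ : rightRegularRep g ∈ StarSubalgebra.centralizer ℂ (Set.range (leftRegularRep G)) := by
    rw [StarSubalgebra.mem_centralizer_iff]
    rintro _ ⟨h, rfl⟩
    rw [star_leftRegularRep]
    exact ⟨leftRegularRep_comm_rightRegularRep h g, leftRegularRep_comm_rightRegularRep h⁻¹ g⟩
  exact (((StarSubalgebra.mem_centralizer_iff ℂ).1 hx) _ hρ).1.symm

theorem apply_ellTwoDelta {x : EllTwo G →L[ℂ] EllTwo G} (hx : x ∈ groupVonNeumannAlgebra G)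
    (g : G) : x (ellTwoDelta g) = rightRegularRep g⁻¹ (x (ellTwoDelta 1)) := by
  have h := congr($(comm_rightRegularRep hx g⁻¹) (ellTwoDelta 1))
  simpa [rightRegularRep_delta] using h

/-- $\delta_1$ is separating for $L(G)$: right translations carry it to every basis vector. -/
theorem eq_of_apply_ellTwoDelta_one {x y : EllTwo G →L[ℂ] EllTwo G}
    (hx : x ∈ groupVonNeumannAlgebra G) (hy : y ∈ groupVonNeumannAlgebra G)
    (h : x (ellTwoDelta 1) = y (ellTwoDelta 1)) : x = y :=
  ContinuousLinearMap.ext_ellTwoDelta fun g => by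
    rw [apply_ellTwoDelta hx, apply_ellTwoDelta hy, h]

theorem star_apply_ellTwoDelta_one {x : EllTwo G →L[ℂ] EllTwo G}
    (hx : x ∈ groupVonNeumannAlgebra G) (g : G) :
    star x (ellTwoDelta 1) g = star (x (ellTwoDelta 1) g⁻¹) := by
  rw [← inner_ellTwoDelta g, ContinuousLinearMap.star_eq_adjoint,
    ContinuousLinearMap.adjoint_inner_right, ← inner_conj_symm, inner_ellTwoDelta,
    apply_ellTwoDelta hx, rightRegularRep_apply, one_mul]
  rfl

/-! ### Relative commutants and factoriality. -/

theorem scalar_mem {H : Type*} [NormedAddCommGroup H] [InnerProductSpace ℂ H] [CompleteSpace H]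
    (M : VonNeumannAlgebra H) : scalarOperators H ⊆ M := by
  rintro _ ⟨c, rfl⟩
  exact M.toStarSubalgebra.smul_mem M.toStarSubalgebra.one_mem c

/-- If every nontrivial element of `G` has infinitely many conjugates by elements of `K`, then
the relative commutant of `L(K)` in `L(G)` is trivial. -/
theorem relativeCommutant_eq_scalarOperators (K : Subgroup G)
    (hK : ∀ g : G, g ≠ 1 → ((fun k => k * g * k⁻¹) '' (K : Set G)).Infinite) :
    ((subgroupVonNeumannAlgebra K).commutant : Set (EllTwo G →L[ℂ] EllTwo G)) ∩
      groupVonNeumannAlgebra G = scalarOperators (EllTwo G) := by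
  refine Set.Subset.antisymm ?_ (Set.subset_inter (scalar_mem _) (scalar_mem _))
  rintro x ⟨hxK, hx⟩
  set f := x (ellTwoDelta 1) with hf
  have hconj : ∀ k ∈ K, ∀ g, f (k * g * k⁻¹) = f g := by
    intro k hk g
    -- Apply $\lambda_{k^{-1}}x = x\lambda_{k^{-1}}$ to $\delta_k$ and evaluate at $g$: the left
    -- side is $(x\delta_k)(kg) = f(kgk^{-1})$, the right side $(x\delta_1)(g) = f(g)$.
    have h1 := VonNeumannAlgebra.mem_commutant_iff.1 hxK _
      (leftRegularRep_mem_subgroup (K.inv_mem hk))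
    have h2 := congr($h1 (ellTwoDelta k) g)
    simp only [mul_apply_eq_comp, leftRegularRep_delta, inv_mul_cancel,
      leftRegularRep_apply, inv_inv] at h2
    rw [apply_ellTwoDelta hx, rightRegularRep_apply] at h2
    exact h2
  have hzero : ∀ g, g ≠ 1 → f g = 0 := by
    intro g hg
    refine EllTwo.eq_zero_of_infinite f _ ((hK g hg).mono ?_)
    rintro _ ⟨k, hk, rfl⟩
    exact hconj k hk g
  refine ⟨f 1, eq_of_apply_ellTwoDelta_one (scalar_mem _ ⟨f 1, rfl⟩) hx ?_⟩
  classical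
  ext g
  by_cases hg : g = 1
  · simp [hg, ellTwoDelta_apply, hf]
  · simp [hg, ellTwoDelta_apply, ← hf, hzero g hg]

/-- The centre of $L(G)$ lies in the relative commutant of the smaller algebra $L(K)$. -/
theorem groupVonNeumannAlgebra_isFactor (K : Subgroup G)
    (hK : ∀ g : G, g ≠ 1 → ((fun k => k * g * k⁻¹) '' (K : Set G)).Infinite) :
    (groupVonNeumannAlgebra G).IsFactor := by
  refine Set.Subset.antisymm ?_ (Set.subset_inter (scalar_mem _) (scalar_mem _))
  rintro x ⟨hx, hx'⟩
  rw [← relativeCommutant_eq_scalarOperators K hK]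
  refine ⟨VonNeumannAlgebra.mem_commutant_iff.2 fun y hy => ?_, hx⟩
  exact VonNeumannAlgebra.mem_commutant_iff.1 hx' y (subgroupVonNeumannAlgebra_le K hy)

theorem subgroupVonNeumannAlgebra_isFactor (K : Subgroup G)
    (hK : ∀ g : G, g ≠ 1 → ((fun k => k * g * k⁻¹) '' (K : Set G)).Infinite) :
    (subgroupVonNeumannAlgebra K).IsFactor := by
  refine Set.Subset.antisymm ?_ (Set.subset_inter (scalar_mem _) (scalar_mem _))
  rintro x ⟨hx, hx'⟩
  rw [← relativeCommutant_eq_scalarOperators K hK]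
  exact ⟨hx', subgroupVonNeumannAlgebra_le K hx⟩

/-! ### Infinite dimension and the trace. -/

theorem not_finiteDimensional_of_leftRegularRep_mem {s : Set G} (hs : s.Infinite)
    (M : VonNeumannAlgebra (EllTwo G)) (hM : ∀ g ∈ s, leftRegularRep G g ∈ M) :
    ¬ FiniteDimensional ℂ M.toStarSubalgebra := by
  classical
  intro hfin
  let v : s → M.toStarSubalgebra := fun g => ⟨leftRegularRep G g, hM g g.2⟩
  have hv : LinearIndependent ℂ v := by
    rw [linearIndependent_iff']
    intro t c hc g hg
    have h1 : ∑ i ∈ t, c i • leftRegularRep G (i : G) = 0 := by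
      have := congrArg (M.toStarSubalgebra.subtype) hc
      simpa [v] using this
    -- The operators $\lambda_i$ send $\delta_1$ to the distinct basis vectors $\delta_i$, so this
    -- matrix coefficient isolates `c g`.
    have h2 := congrArg (fun T => inner ℂ (ellTwoDelta (g : G)) (T (ellTwoDelta 1))) h1
    simpa [sum_apply, inner_sum, inner_smul_right, leftRegularRep_delta,
      inner_ellTwoDelta, ellTwoDelta_apply, hg, Subtype.coe_inj] using h2
  have := hv.finite
  exact hs (Set.toFinite s)

open scoped ComplexOrder in
/-- The vector state of `δ_1` is a faithful normal trace on subalgebras of `L(G)`. -/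
theorem exists_isFaithfulNormalTrace (M : VonNeumannAlgebra (EllTwo G))
    (hM : M ≤ groupVonNeumannAlgebra G) :
    ∃ τ : M.toStarSubalgebra →ₗ[ℂ] ℂ, M.IsFaithfulNormalTrace τ := by
  let τ : M.toStarSubalgebra →ₗ[ℂ] ℂ :=
    { toFun := fun x => inner ℂ (ellTwoDelta 1) ((x : EllTwo G →L[ℂ] EllTwo G) (ellTwoDelta 1))
      map_add' := fun x y => by simp
      map_smul' := fun c x => by simp }
  have hτ : ∀ x, τ x = inner ℂ (ellTwoDelta 1)
    ((x : EllTwo G →L[ℂ] EllTwo G) (ellTwoDelta 1)) := fun _ => rfl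
  have hmem : ∀ x : M.toStarSubalgebra,
      (x : EllTwo G →L[ℂ] EllTwo G) ∈ groupVonNeumannAlgebra G := fun x => hM x.2
  have hss : ∀ x, τ (star x * x) = (‖(x : EllTwo G →L[ℂ] EllTwo G) (ellTwoDelta 1)‖ : ℂ) ^ 2 := by
    intro x
    rw [hτ]
    simp only [MulMemClass.coe_mul, StarMemClass.coe_star, mul_apply_eq_comp]
    rw [ContinuousLinearMap.star_eq_adjoint, ContinuousLinearMap.adjoint_inner_right,
      inner_self_eq_norm_sq_to_K]
    rfl
  have hmul : ∀ x y, τ (x * y) = ∑' g, (x : EllTwo G →L[ℂ] EllTwo G) (ellTwoDelta 1) g⁻¹ *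
      (y : EllTwo G →L[ℂ] EllTwo G) (ellTwoDelta 1) g := by
    intro x y
    rw [hτ]
    simp only [MulMemClass.coe_mul, mul_apply_eq_comp]
    rw [← ContinuousLinearMap.adjoint_inner_left, lp.inner_eq_tsum]
    refine tsum_congr fun g => ?_
    rw [← ContinuousLinearMap.star_eq_adjoint, star_apply_ellTwoDelta_one (hmem x)]
    simp [mul_comm]
  refine ⟨τ, ?_, fun x => ?_, fun x y => ?_, fun x h => ?_,
    fun n => if n = 0 then ellTwoDelta 1 else 0, ?_, fun x => ?_⟩
  · exact (inner_ellTwoDelta _ _).trans (ellTwoDelta_apply_self 1)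
  · rw [hss]
    exact_mod_cast sq_nonneg (‖(x : EllTwo G →L[ℂ] EllTwo G) (ellTwoDelta 1)‖)
  -- The substitution $g \mapsto g^{-1}$ exchanges the roles of `x` and `y` in the sum.
  · rw [hmul, hmul, ← (Equiv.inv G).tsum_eq]
    simp [mul_comm]
  · rw [hss] at h
    have h0 : (x : EllTwo G →L[ℂ] EllTwo G) (ellTwoDelta 1) = 0 := by simpa using h
    refine Subtype.ext (eq_of_apply_ellTwoDelta_one (hmem x) (hmem 0) ?_)
    simpa using h0
  · exact summable_of_ne_finset_zero (s := {0}) fun n hn => by simp_all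
  · convert hasSum_single (f := fun n : ℕ => inner ℂ (if n = 0 then ellTwoDelta 1 else 0)
      ((x : EllTwo G →L[ℂ] EllTwo G) (if n = 0 then ellTwoDelta 1 else 0))) 0
      (fun n hn => by simp [hn]) using 1
    simp [hτ]

/-- If `K` is infinite and every nontrivial element of `G` has infinitely many conjugates by
elements of `K`, then `L(K) ⊆ L(G)` is an irreducible inclusion of II₁ factors. -/
theorem isIrreducibleInclusion_of_infinite_conjugates (K : Subgroup G) (hinf : (K : Set G).Infinite)
    (hK : ∀ g : G, g ≠ 1 → ((fun k => k * g * k⁻¹) '' (K : Set G)).Infinite) :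
    (subgroupVonNeumannAlgebra K).IsTypeIIOneFactor ∧
      (groupVonNeumannAlgebra G).IsTypeIIOneFactor ∧
      VonNeumannAlgebra.IsIrreducibleInclusion
        (subgroupVonNeumannAlgebra K) (groupVonNeumannAlgebra G) :=
  have hN := subgroupVonNeumannAlgebra_isFactor K hK
  have hM := groupVonNeumannAlgebra_isFactor K hK
  have hle := subgroupVonNeumannAlgebra_le K
  ⟨⟨hN, not_finiteDimensional_of_leftRegularRep_mem hinf _ fun _ => leftRegularRep_mem_subgroup,
      exists_isFaithfulNormalTrace _ hle⟩,
    ⟨hM, not_finiteDimensional_of_leftRegularRep_mem hinf _ fun g _ => leftRegularRep_mem g,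
      exists_isFaithfulNormalTrace _ le_rfl⟩,
    hN, hM, hle, relativeCommutant_eq_scalarOperators K hK⟩

end Operators

/-! ## Local rearrangements in similarity structure groups -/

section Balls

variable {X : Type*} [MetricSpace X]

theorem ClosedBall.nonempty (B : ClosedBall X) : B.1.Nonempty := by
  obtain ⟨x, r, hr, h⟩ := B.2
  exact ⟨x, h ▸ Metric.mem_closedBall_self hr.le⟩

theorem ClosedBall.exists_subset_of_isOpen {U : Set X} (hU : IsOpen U) {x : X} (hx : x ∈ U) :
    ∃ B : ClosedBall X, x ∈ B.1 ∧ B.1 ⊆ U := by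
  obtain ⟨r, hr, h⟩ := Metric.nhds_basis_closedBall.mem_iff.1 (hU.mem_nhds hx)
  exact ⟨⟨_, x, r, hr, rfl⟩, Metric.mem_closedBall_self hr.le, h⟩

theorem ClosedBall.isClosed (B : ClosedBall X) : IsClosed B.1 := by
  obtain ⟨x, r, -, h⟩ := B.2
  exact h ▸ Metric.isClosed_closedBall

theorem ClosedBall.ne_univ_of_disjoint {B C : ClosedBall X} (h : Disjoint B.1 C.1) :
    B.1 ≠ Set.univ := by
  intro hB
  rw [hB, Set.univ_disjoint] at h
  exact C.nonempty.ne_empty h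

/-! ### Involutions exchanging two disjoint similar balls. -/

namespace SimilarityStructure

open Classical in
/-- The map exchanging `B` and `D` by means of `h` and fixing all other points. -/
noncomputable def swapFun {B D : ClosedBall X} (h : B.1 ≃ D.1) (x : X) : X :=
  if hB : x ∈ B.1 then h ⟨x, hB⟩ else if hD : x ∈ D.1 then h.symm ⟨x, hD⟩ else x

section Swap

variable {B D : ClosedBall X} (h : B.1 ≃ D.1)

theorem swapFun_of_mem_left (x : B.1) : swapFun h x = h x := by
  simp [swapFun]

theorem swapFun_of_mem_right (hBD : Disjoint B.1 D.1) (x : D.1) : swapFun h x = h.symm x := by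
  simp [swapFun, hBD.symm.notMem_of_mem_left x.2]

theorem swapFun_of_notMem {x : X} (hB : x ∉ B.1) (hD : x ∉ D.1) : swapFun h x = x := by
  simp [swapFun, hB, hD]

theorem swapFun_involutive (hBD : Disjoint B.1 D.1) : Function.Involutive (swapFun h) := by
  intro x
  by_cases hB : x ∈ B.1
  · have h1 := swapFun_of_mem_left h ⟨x, hB⟩
    have h2 := swapFun_of_mem_right h hBD (h ⟨x, hB⟩)
    simp_all
  by_cases hD : x ∈ D.1
  · have h1 := swapFun_of_mem_right h hBD ⟨x, hD⟩
    have h2 := swapFun_of_mem_left h (h.symm ⟨x, hD⟩)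
    simp_all
  · simp [swapFun_of_notMem h hB hD]

variable {h}

theorem swapFun_locallyDetermined {S : SimilarityStructure X} (hBD : Disjoint B.1 D.1)
    (hh : h ∈ S.Sim B D) : S.LocallyDetermined (swapFun h) := by
  intro x
  by_cases hB : x ∈ B.1
  · exact ⟨B, D, hB, h, hh, fun y => (swapFun_of_mem_left h y).symm⟩
  by_cases hD : x ∈ D.1
  · exact ⟨D, B, hD, h.symm, S.symm_mem hh, fun y => (swapFun_of_mem_right h hBD y).symm⟩
  obtain ⟨E, hxE, hE⟩ := ClosedBall.exists_subset_of_isOpen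
    (B.isClosed.isOpen_compl.inter D.isClosed.isOpen_compl) (x := x) ⟨hB, hD⟩
  exact ⟨E, E, hxE, Equiv.refl _, S.refl_mem E, fun y =>
    (swapFun_of_notMem h (hE y.2).1 (hE y.2).2).symm⟩

end Swap

end SimilarityStructure

variable [IsUltrametricDist X]

theorem ClosedBall.isOpen (B : ClosedBall X) : IsOpen B.1 := by
  obtain ⟨x, r, hr, h⟩ := B.2
  exact h ▸ IsUltrametricDist.isOpen_closedBall x hr.ne'

namespace SimilarityStructure

variable (S : SimilarityStructure X)

theorem LocallyDetermined.continuous {S : SimilarityStructure X} {g : X → X}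
    (hg : S.LocallyDetermined g) : Continuous g := by
  rw [continuous_iff_continuousAt]
  intro x
  obtain ⟨B, B', hx, h, hh, hgh⟩ := hg x
  obtain ⟨c, hc, hd⟩ := S.similarity hh
  have hcont : Continuous h :=
    (LipschitzWith.of_dist_le_mul (K := ⟨c, hc.le⟩) fun a b => (hd a b).le).continuous
  have hon : ContinuousOn g B.1 := by
    rw [continuousOn_iff_continuous_domRestrict]
    exact (continuous_subtype_val.comp hcont).congr hgh
  exact hon.continuousAt (B.isOpen.mem_nhds hx)

section Swap

variable {B D : ClosedBall X} {h : B.1 ≃ D.1}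

theorem exists_swap {S : SimilarityStructure X} (hBD : Disjoint B.1 D.1) (hh : h ∈ S.Sim B D) :
    ∃ s : S.group, ∀ x, (s : X ≃ₜ X) x = swapFun h x := by
  have hl := swapFun_locallyDetermined hBD hh
  exact ⟨⟨{ toEquiv := (swapFun_involutive h hBD).toPerm
            continuous_toFun := hl.continuous
            continuous_invFun := hl.continuous }, hl⟩, fun _ => rfl⟩

end Swap

/-! ### Supports and commutators. -/

/-- The elements of the group that fix every point outside `U`. -/
def supportedIn (U : Set X) : Subgroup S.group where
  carrier := {k | ∀ x ∉ U, (k : X ≃ₜ X) x = x}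
  one_mem' := fun _ _ => rfl
  mul_mem' := by
    intro a b ha hb x hx
    change (a : X ≃ₜ X) ((b : X ≃ₜ X) x) = x
    rw [hb x hx, ha x hx]
  inv_mem' := by
    intro a ha x hx
    exact (Homeomorph.symm_apply_eq _).2 (ha x hx).symm

variable {S}

theorem supportedIn_mono {U V : Set X} (h : U ⊆ V) : S.supportedIn U ≤ S.supportedIn V :=
  fun _ hk x hx => hk x fun hU => hx (h hU)

/-- An element supported in disjoint sets is trivial. -/
theorem eq_one_of_mem_supportedIn {U V : Set X} (h : Disjoint U V) {k : S.group}
    (hU : k ∈ S.supportedIn U) (hV : k ∈ S.supportedIn V) : k = 1 := by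
  refine Subtype.ext (Homeomorph.ext fun x => ?_)
  by_cases hx : x ∈ U
  · exact hV x (h.notMem_of_mem_left hx)
  · exact hU x hx

open scoped commutatorElement in
/-- If three disjoint balls in `U` are similar, some nontrivial commutator is supported in `U`. -/
theorem exists_commutator_ne_one {U : Set X} {B C D : ClosedBall X} (hB : B.1 ⊆ U) (hC : C.1 ⊆ U)
    (hD : D.1 ⊆ U) (hBC : Disjoint B.1 C.1) (hBD : Disjoint B.1 D.1) (hCD : Disjoint C.1 D.1)
    (hC' : (S.Sim B C).Nonempty) (hD' : (S.Sim B D).Nonempty) :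
    ∃ k ∈ commutator S.group ⊓ S.supportedIn U, k ≠ 1 := by
  obtain ⟨h, hh⟩ := hC'
  obtain ⟨h', hh'⟩ := hD'
  obtain ⟨s, hs⟩ := exists_swap hBC hh
  obtain ⟨t, ht⟩ := exists_swap hBD hh'
  have hsU : s ∈ S.supportedIn U := fun x hx => by
    rw [hs, swapFun_of_notMem h (fun hx' => hx (hB hx')) fun hx' => hx (hC hx')]
  have htU : t ∈ S.supportedIn U := fun x hx => by
    rw [ht, swapFun_of_notMem h' (fun hx' => hx (hB hx')) fun hx' => hx (hD hx')]
  have hst : s * t * s⁻¹ * t⁻¹ ∈ S.supportedIn U :=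
    mul_mem (mul_mem (mul_mem hsU htU) (inv_mem hsU)) (inv_mem htU)
  refine ⟨⁅s, t⁆, ⟨Subgroup.commutator_mem_commutator (Subgroup.mem_top _) (Subgroup.mem_top _),
    hst⟩, fun hst => ?_⟩
  rw [commutatorElement_eq_one_iff_mul_comm] at hst
  -- For $x \in B$, $st$ sends $x$ into $D$, which `s` fixes pointwise, while $ts$ sends it into
  -- $C$, which `t` fixes pointwise; $C$ and $D$ are disjoint.
  obtain ⟨x, hx⟩ := B.nonempty
  have h1 : (s : X ≃ₜ X) ((t : X ≃ₜ X) x) = (t : X ≃ₜ X) ((s : X ≃ₜ X) x) :=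
    congrArg (fun k : S.group => (k : X ≃ₜ X) x) hst
  simp only [hs, ht] at h1
  rw [swapFun_of_mem_left h ⟨x, hx⟩, swapFun_of_mem_left h' ⟨x, hx⟩,
    swapFun_of_notMem h (hBD.symm.notMem_of_mem_left (h' _).2)
      (hCD.symm.notMem_of_mem_left (h' _).2),
    swapFun_of_notMem h' (hBC.symm.notMem_of_mem_left (h _).2)
      (hCD.notMem_of_mem_left (h _).2)] at h1
  exact hCD.notMem_of_mem_left (h ⟨x, hx⟩).2 (h1 ▸ (h' ⟨x, hx⟩).2)

variable
  (hsplit : ∀ B : ClosedBall X, ∃ B₁ B₂ : ClosedBall X,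
    B₁.1 ⊆ B.1 ∧ B₂.1 ⊆ B.1 ∧ Disjoint B₁.1 B₂.1)
  (hsim : ∀ B D : ClosedBall X, B.1 ≠ Set.univ → D.1 ≠ Set.univ →
    ∃ D₀ : ClosedBall X, D₀.1 ⊆ D.1 ∧ (S.Sim B D₀).Nonempty)

include hsplit hsim

/-- Two splittings give disjoint $B$, $C$, $D$ inside $U$, and copies of $B$ are placed in $C$ and
$D$. Each of the three is proper because it misses another ball, as `hsim` requires. -/
theorem exists_commutator_ne_one_of_ball (U : ClosedBall X) :
    ∃ k ∈ commutator S.group ⊓ S.supportedIn U.1, k ≠ 1 := by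
  obtain ⟨B, B', hB, hB', hd⟩ := hsplit U
  obtain ⟨C, D, hC, hD, hCD⟩ := hsplit B'
  have hBu := ClosedBall.ne_univ_of_disjoint hd
  obtain ⟨C₀, hC₀, hBC⟩ := hsim B C hBu (ClosedBall.ne_univ_of_disjoint hCD)
  obtain ⟨D₀, hD₀, hBD⟩ := hsim B D hBu (ClosedBall.ne_univ_of_disjoint hCD.symm)
  exact exists_commutator_ne_one hB (hC₀.trans (hC.trans hB')) (hD₀.trans (hD.trans hB'))
    (hd.mono_right (hC₀.trans hC)) (hd.mono_right (hD₀.trans hD)) (hCD.mono hC₀ hD₀) hBC hBD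

theorem infinite_commutator_inf_supportedIn (U : ClosedBall X) :
    ((commutator S.group ⊓ S.supportedIn U.1 : Subgroup S.group) : Set S.group).Infinite := by
  set K : ClosedBall X → Set S.group := fun U =>
    ((commutator S.group ⊓ S.supportedIn U.1 : Subgroup S.group) : Set S.group) with hK
  intro hfin
  -- For disjoint $B, C \subseteq U$, a nontrivial commutator supported in $C$ lies in `K U` but not
  -- in `K B`, so passing to $B$ strictly lowers a finite cardinality; the bound must hold for all
  -- balls at once.
  have key : ∀ n : ℕ, ∀ U : ClosedBall X, (K U).Finite → n ≤ (K U).ncard := by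
    intro n
    induction n with
    | zero => exact fun _ _ => Nat.zero_le _
    | succ n ih =>
      intro U hU
      obtain ⟨B, C, hB, hC, hBC⟩ := hsplit U
      have hsub : K B ⊆ K U := fun k hk => ⟨hk.1, supportedIn_mono hB hk.2⟩
      obtain ⟨k, hk, hk1⟩ := exists_commutator_ne_one_of_ball hsplit hsim C
      have hss : K B ⊂ K U := (Set.ssubset_iff_of_subset hsub).2
        ⟨k, ⟨hk.1, supportedIn_mono hC hk.2⟩, fun hkB =>
          hk1 (eq_one_of_mem_supportedIn hBC hkB.2 hk.2)⟩
      exact (ih B (hU.subset hsub)).trans_lt (Set.ncard_lt_ncard hss hU)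
  exact (Nat.lt_succ_self _).not_ge (key ((K U).ncard + 1) U hfin)

/-- Every nontrivial element has infinitely many conjugates by elements of the commutator
subgroup. -/
theorem infinite_conjugates (g : S.group) (hg : g ≠ 1) :
    ((fun k => k * g * k⁻¹) '' (commutator S.group : Set S.group)).Infinite := by
  obtain ⟨x, hx⟩ : ∃ x, (g : X ≃ₜ X) x ≠ x := by
    by_contra! hcon
    exact hg (Subtype.ext (Homeomorph.ext hcon))
  obtain ⟨V, W, hV, hW, hxV, hxW, hVW⟩ := t2_separation hx
  obtain ⟨U, hxU, hU⟩ := ClosedBall.exists_subset_of_isOpen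
    ((hV.preimage (g : X ≃ₜ X).continuous).inter hW) (x := x) ⟨hxV, hxW⟩
  have hgU : ∀ y ∈ U.1, (g : X ≃ₜ X) y ∉ U.1 := fun y hy hy' =>
    hVW.notMem_of_mem_left (hU hy).1 (hU hy').2
  -- It suffices that $k \mapsto kgk^{-1}$ is injective on commutators supported in $U$, where $g(U)
  -- \cap U = \emptyset$.
  refine Set.Infinite.mono (Set.image_mono Set.inter_subset_left)
    ((infinite_commutator_inf_supportedIn hsplit hsim U).image ?_)
  intro a ha b hb hab
  have hk : b⁻¹ * a ∈ S.supportedIn U.1 := mul_mem (inv_mem hb.2) ha.2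
  have hcomm : g * (b⁻¹ * a) = (b⁻¹ * a) * g := by
    have hab' : a * g * a⁻¹ = b * g * b⁻¹ := hab
    have : b⁻¹ * (a * g * a⁻¹) * a = b⁻¹ * (b * g * b⁻¹) * a := by rw [hab']
    simpa [mul_assoc] using this.symm
  have hone : b⁻¹ * a = 1 := by
    refine Subtype.ext (Homeomorph.ext fun y => ?_)
    -- Put $c = b^{-1}a$, which commutes with $g$. For $y \in U$ the point $g(y)$ lies outside $U$
    -- and is fixed by $c$, so $g(c(y)) = c(g(y)) = g(y)$ and $c(y) = y$.
    by_cases hy : y ∈ U.1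
    · have h1 : (g : X ≃ₜ X) (((b⁻¹ * a : S.group) : X ≃ₜ X) y) =
          ((b⁻¹ * a : S.group) : X ≃ₜ X) ((g : X ≃ₜ X) y) :=
        congrArg (fun k : S.group => (k : X ≃ₜ X) y) hcomm
      rw [hk _ (hgU y hy)] at h1
      exact (g : X ≃ₜ X).injective h1
    · exact hk y hy
  exact (inv_mul_eq_one.1 hone).symm

end SimilarityStructure

end Balls

theorem mainTheorem11 {X : Type*} [MetricSpace X] [CompactSpace X] [IsUltrametricDist X]
    (Γ : Subgroup (X ≃ₜ X)) (hΓ : IsCSSStarGroup Γ)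
    (hballs : ∀ B : ClosedBall X, B.1.Infinite) :
    (subgroupVonNeumannAlgebra (commutator Γ)).IsTypeIIOneFactor ∧
      (groupVonNeumannAlgebra Γ).IsTypeIIOneFactor ∧
      VonNeumannAlgebra.IsIrreducibleInclusion
        (subgroupVonNeumannAlgebra (commutator Γ)) (groupVonNeumannAlgebra Γ) := by
  obtain ⟨hX, S, -, rfl, hsplit, hsim⟩ := hΓ
  have hsplit' : ∀ B : ClosedBall X, ∃ B₁ B₂ : ClosedBall X,
      B₁.1 ⊆ B.1 ∧ B₂.1 ⊆ B.1 ∧ Disjoint B₁.1 B₂.1 := fun B => by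
    obtain ⟨B₁, B₂, h₁, h₂, -, -, hd⟩ := hsplit B (hballs B)
    exact ⟨B₁, B₂, h₁, h₂, hd⟩
  have hsim' := fun B D : ClosedBall X => fun hB hD => hsim B D hB hD (hballs D)
  obtain ⟨x⟩ := hX.nonempty
  obtain ⟨U, -, -⟩ := ClosedBall.exists_subset_of_isOpen isOpen_univ (Set.mem_univ x)
  exact isIrreducibleInclusion_of_infinite_conjugates _
    ((SimilarityStructure.infinite_commutator_inf_supportedIn hsplit' hsim' U).mono
      Set.inter_subset_left)
    (SimilarityStructure.infinite_conjugates hsplit' hsim')
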